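/- Let $(\mathcal{C},\mathbb{E},\mathfrak{s})$ be an extriangulated category (in the sense of Nakaoka and Palu), and let $\xi$ be a proper class of $\mathbb{E}$-triangles in it; that is, $\xi$ is a class of $\mathbb{E}$-triangles which is closed under isomorphisms, finite coproducts, base change and cobase change, contains all split $\mathbb{E}$-triangles, and is saturated. Here saturated means the following. Let $A_1\xrightarrow{x_1}B_1\xrightarrow{y_1}C\overset{\delta_1}{\dashrightarrow}$ and $A_2\xrightarrow{x_2}B_2\xrightarrow{y_2}C\overset{\delta_2}{\dashrightarrow}$ be $\mathbb{E}$-triangles, and let $A_1\xrightarrow{m_1}M\xrightarrow{e_1}B_2$ and $A_2\xrightarrow{m_2}M\xrightarrow{e_2}B_1$ realize $y_2^*\delta_1$ and $y_1^*\delta_2$ respectively, with $e_1m_2=x_2$, $e_2m_1=x_1$ and $y_1e_2=y_2e_1$. If the $\mathbb{E}$-triangles $A_2\to B_2\to C\overset{\delta_2}{\dashrightarrow}$ and $A_1\to M\to B_2\overset{y_2^*\delta_1}{\dashrightarrow}$ belong to $\xi$, then so does $A_1\to B_1\to C\overset{\delta_1}{\dashrightarrow}$. An object $P$ is $\xi$-projective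 if $0\to\mathcal{C}(P,A)\to\mathcal{C}(P,B)\to\mathcal{C}(P,C)\to 0$ is exact for every $\mathbb{E}$-triangle $A\to B\to C\dashrightarrow$ in $\xi$; dually, $I$ is $\xi$-injective if $0\to\mathcal{C}(C,I)\to\mathcal{C}(B,I)\to\mathcal{C}(A,I)\to 0$ is exact for every such $\mathbb{E}$-triangle. Write $\mathcal{P}(\xi)$ and $\mathcal{I}(\xi)$ for the classes of $\xi$-projective and $\xi$-injective objects. The $\xi$-projective dimension $\xi\text{-}\mathrm{pd}\,A\in\mathbb{N}\cup\{\infty\}$ is defined inductively: $\xi\text{-}\mathrm{pd}\,A\le 0$ if $A\in\mathcal{P}(\xi)$; for $n\ge 1$, $\xi\text{-}\mathrm{pd}\,A\le n$ if $A\in\mathcal{P}(\xi)$ or there is an $\mathbb{E}$-triangle $K\to P\to A\dashrightarrow$ in $\xi$ with $P\in\mathcal{P}(\xi)$ and $\xi\text{-}\mathrm{pd}\,K\le n-1$; and $\xi\text{-}\mathrm{pd}\,A$ is the least such $n$, or $\infty$ if there is none. The $\xi$-injective dimension $\xi\text{-}\mathrm{id}\,A$ is defined dually. Put $$\xi\text{-}\mathrm{silp}\,\mathcal{C}=\sup\{\xi\text{-}\mathrm{id}\,P\mid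 P\in\mathcal{P}(\xi)\},\qquad \xi\text{-}\mathrm{spli}\,\mathcal{C}=\sup\{\xi\text{-}\mathrm{pd}\,I\mid I\in\mathcal{I}(\xi)\}.$$ If both $\xi\text{-}\mathrm{silp}\,\mathcal{C}$ and $\xi\text{-}\mathrm{spli}\,\mathcal{C}$ are finite, then $\xi\text{-}\mathrm{silp}\,\mathcal{C}=\xi\text{-}\mathrm{spli}\,\mathcal{C}$. -/

import Mathlib

open CategoryTheory CategoryTheory.Limits Opposite

universe w v u

/-- A sequence `A ⟶ B ⟶ C` of two composable morphisms with fixed ends `A` and `C`. -/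
structure TwoTermSeq {𝒞 : Type u} [Category.{v} 𝒞] (A C : 𝒞) where
  /-- the middle object -/
  mid : 𝒞
  /-- the first morphism -/
  fst : A ⟶ mid
  /-- the second morphism -/
  snd : mid ⟶ C

/-- Two sequences `A ⟶ B ⟶ C` and `A ⟶ B' ⟶ C` are equivalent if there is an isomorphism
`B ≅ B'` compatible with the morphisms from `A` and to `C`. -/
instance TwoTermSeq.setoid {𝒞 : Type u} [Category.{v} 𝒞] (A C : 𝒞) :
    Setoid (TwoTermSeq A C) where
  r S T := ∃ b : S.mid ≅ T.mid, S.fst ≫ b.hom = T.fst ∧ b.hom ≫ T.snd = S.snd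
  iseqv :=
    { refl := fun S => ⟨Iso.refl _, by simp, by simp⟩
      symm := by
        rintro S T ⟨b, h₁, h₂⟩
        exact ⟨b.symm, by simp [← h₁], by simp [← h₂]⟩
      trans := by
        rintro S T U ⟨b, h₁, h₂⟩ ⟨b', h₁', h₂'⟩
        exact ⟨b ≪≫ b', by simp [reassoc_of% h₁, h₁'], by simp [h₂', h₂]⟩ }

/-- The data underlying an extriangulated category: an additive bifunctor
`𝔼 : 𝒞ᵒᵖ × 𝒞 ⥤ Ab` together with a correspondence `𝔰` that associates to each
`δ ∈ 𝔼(C, A)` an equivalence class of sequences `A ⟶ B ⟶ C`. -/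
structure PreExtriangulated (𝒞 : Type u) [Category.{v} 𝒞] [Preadditive 𝒞] where
  /-- the bifunctor -/
  E : 𝒞ᵒᵖ ⥤ 𝒞 ⥤ AddCommGrpCat.{w}
  additive_left : E.Additive
  additive_right : ∀ X : 𝒞ᵒᵖ, (E.obj X).Additive
  /-- the correspondence -/
  s : ∀ {C A : 𝒞}, ((E.obj (op C)).obj A : Type w) → Quotient (TwoTermSeq.setoid A C)

namespace PreExtriangulated

variable {𝒞 : Type u} [Category.{v} 𝒞] [Preadditive 𝒞] (𝓔 : PreExtriangulated.{w} 𝒞)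

/-- The group `𝔼(C, A)` of extensions. -/
abbrev Ext (C A : 𝒞) : Type w := ((𝓔.E.obj (op C)).obj A : Type w)

/-- `a_* δ = 𝔼(C, a)(δ)`. -/
def push {C A A' : 𝒞} (a : A ⟶ A') (δ : 𝓔.Ext C A) : 𝓔.Ext C A' :=
  ((𝓔.E.obj (op C)).map a).hom δ

/-- `c^* δ = 𝔼(c, A)(δ)`. -/
def pull {C C' A : 𝒞} (c : C' ⟶ C) (δ : 𝓔.Ext C A) : 𝓔.Ext C' A :=
  ((𝓔.E.map c.op).app A).hom δ

/-- `𝔰(δ) = [A -x⟶ B -y⟶ C]`, i.e. `A -x⟶ B -y⟶ C ⇢δ` is an `𝔼`-triangle. -/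
def IsTriangle {A B C : 𝒞} (x : A ⟶ B) (y : B ⟶ C) (δ : 𝓔.Ext C A) : Prop :=
  𝓔.s δ = Quotient.mk (TwoTermSeq.setoid A C) ⟨B, x, y⟩

/-- The direct sum `δ ⊕ δ' ∈ 𝔼(C ⊕ C', A ⊕ A')`, the element whose components in
`𝔼(C, A) ⊕ 𝔼(C, A') ⊕ 𝔼(C', A) ⊕ 𝔼(C', A')` are `(δ, 0, 0, δ')`. -/
noncomputable def sum [HasBinaryBiproducts 𝒞] {C A C' A' : 𝒞} (δ : 𝓔.Ext C A)
    (δ' : 𝓔.Ext C' A') : 𝓔.Ext (C ⊞ C') (A ⊞ A') :=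
  𝓔.push biprod.inl (𝓔.pull biprod.fst δ) + 𝓔.push biprod.inr (𝓔.pull biprod.snd δ')

end PreExtriangulated

/-- An extriangulated structure `(𝔼, 𝔰)` on an additive category `𝒞`
(in the sense of Nakaoka and Palu). -/
structure Extriangulated (𝒞 : Type u) [Category.{v} 𝒞] [Preadditive 𝒞]
    [HasZeroObject 𝒞] [HasBinaryBiproducts 𝒞] extends PreExtriangulated.{w} 𝒞 where
  /-- `𝔰` is a realization: every morphism `(a, c) : δ ⟶ δ'` of extensions is realized. -/
  realize : ∀ {A B C A' B' C' : 𝒞} {x : A ⟶ B} {y : B ⟶ C} {x' : A' ⟶ B'} {y' : B' ⟶ C'}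
    {δ : toPreExtriangulated.Ext C A} {δ' : toPreExtriangulated.Ext C' A'},
    toPreExtriangulated.IsTriangle x y δ → toPreExtriangulated.IsTriangle x' y' δ' →
    ∀ (a : A ⟶ A') (c : C ⟶ C'),
      toPreExtriangulated.push a δ = toPreExtriangulated.pull c δ' →
      ∃ b : B ⟶ B', x ≫ b = a ≫ x' ∧ y ≫ c = b ≫ y'
  /-- The realization is additive: `𝔰(0) = [A ⟶ A ⊕ C ⟶ C]`. -/
  realize_zero : ∀ A C : 𝒞,
    toPreExtriangulated.IsTriangle (biprod.inl : A ⟶ A ⊞ C) (biprod.snd : A ⊞ C ⟶ C) 0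
  /-- The realization is additive: `𝔰(δ ⊕ δ') = 𝔰(δ) ⊕ 𝔰(δ')`. -/
  realize_sum : ∀ {A B C A' B' C' : 𝒞} {x : A ⟶ B} {y : B ⟶ C} {x' : A' ⟶ B'} {y' : B' ⟶ C'}
    {δ : toPreExtriangulated.Ext C A} {δ' : toPreExtriangulated.Ext C' A'},
    toPreExtriangulated.IsTriangle x y δ → toPreExtriangulated.IsTriangle x' y' δ' →
    toPreExtriangulated.IsTriangle (biprod.map x x') (biprod.map y y')
      (toPreExtriangulated.sum δ δ')
  /-- (ET3) -/
  et3 : ∀ {A B C A' B' C' : 𝒞} {x : A ⟶ B} {y : B ⟶ C} {x' : A' ⟶ B'} {y' : B' ⟶ C'}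
    {δ : toPreExtriangulated.Ext C A} {δ' : toPreExtriangulated.Ext C' A'},
    toPreExtriangulated.IsTriangle x y δ → toPreExtriangulated.IsTriangle x' y' δ' →
    ∀ (a : A ⟶ A') (b : B ⟶ B'), x ≫ b = a ≫ x' →
      ∃ c : C ⟶ C', y ≫ c = b ≫ y' ∧
        toPreExtriangulated.push a δ = toPreExtriangulated.pull c δ'
  /-- (ET3)ᵒᵖ -/
  et3_op : ∀ {A B C A' B' C' : 𝒞} {x : A ⟶ B} {y : B ⟶ C} {x' : A' ⟶ B'} {y' : B' ⟶ C'}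
    {δ : toPreExtriangulated.Ext C A} {δ' : toPreExtriangulated.Ext C' A'},
    toPreExtriangulated.IsTriangle x y δ → toPreExtriangulated.IsTriangle x' y' δ' →
    ∀ (b : B ⟶ B') (c : C ⟶ C'), y ≫ c = b ≫ y' →
      ∃ a : A ⟶ A', x ≫ b = a ≫ x' ∧
        toPreExtriangulated.push a δ = toPreExtriangulated.pull c δ'
  /-- (ET4) -/
  et4 : ∀ {A B C D F : 𝒞} {f : A ⟶ B} {f' : B ⟶ D} {g : B ⟶ C} {g' : C ⟶ F}
    {δ : toPreExtriangulated.Ext D A} {δ' : toPreExtriangulated.Ext F B},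
    toPreExtriangulated.IsTriangle f f' δ → toPreExtriangulated.IsTriangle g g' δ' →
    ∃ (X : 𝒞) (h : A ⟶ C) (h' : C ⟶ X) (d : D ⟶ X) (e : X ⟶ F)
      (δ'' : toPreExtriangulated.Ext X A),
      f ≫ g = h ∧ f' ≫ d = g ≫ h' ∧ h' ≫ e = g' ∧
      toPreExtriangulated.IsTriangle h h' δ'' ∧
      toPreExtriangulated.IsTriangle d e (toPreExtriangulated.push f' δ') ∧
      toPreExtriangulated.pull d δ'' = δ ∧
      toPreExtriangulated.push f δ'' = toPreExtriangulated.pull e δ'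
  /-- (ET4)ᵒᵖ -/
  et4_op : ∀ {A B C D F : 𝒞} {f' : D ⟶ A} {f : A ⟶ B} {g' : F ⟶ B} {g : B ⟶ C}
    {δ : toPreExtriangulated.Ext B D} {δ' : toPreExtriangulated.Ext C F},
    toPreExtriangulated.IsTriangle f' f δ → toPreExtriangulated.IsTriangle g' g δ' →
    ∃ (X : 𝒞) (d : D ⟶ X) (e : X ⟶ F) (h' : X ⟶ A) (h : A ⟶ C)
      (δ'' : toPreExtriangulated.Ext C X),
      f ≫ g = h ∧ d ≫ h' = f' ∧ h' ≫ f = e ≫ g' ∧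
      toPreExtriangulated.IsTriangle h' h δ'' ∧
      toPreExtriangulated.IsTriangle d e (toPreExtriangulated.pull g' δ) ∧
      toPreExtriangulated.push e δ'' = δ' ∧
      toPreExtriangulated.push d δ = toPreExtriangulated.pull g δ''

/-- A proper class `ξ` of `𝔼`-triangles: `mem x y δ` says that the `𝔼`-triangle
`A -x⟶ B -y⟶ C ⇢δ` belongs to `ξ`. -/
structure ProperClass {𝒞 : Type u} [Category.{v} 𝒞] [Preadditive 𝒞]
    [HasZeroObject 𝒞] [HasBinaryBiproducts 𝒞]
    (𝓔 : Extriangulated.{w} 𝒞) where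
  /-- membership in the class -/
  mem : ∀ {A B C : 𝒞}, (A ⟶ B) → (B ⟶ C) → 𝓔.Ext C A → Prop
  /-- the members are `𝔼`-triangles -/
  isTriangle : ∀ {A B C : 𝒞} {x : A ⟶ B} {y : B ⟶ C} {δ : 𝓔.Ext C A},
    mem x y δ → 𝓔.IsTriangle x y δ
  /-- closed under isomorphisms of `𝔼`-triangles -/
  iso_closed : ∀ {A B C A' B' C' : 𝒞} {x : A ⟶ B} {y : B ⟶ C} {x' : A' ⟶ B'} {y' : B' ⟶ C'}
    {δ : 𝓔.Ext C A} {δ' : 𝓔.Ext C' A'}, mem x y δ → 𝓔.IsTriangle x' y' δ' →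
    ∀ (a : A ≅ A') (b : B ≅ B') (c : C ≅ C'), x ≫ b.hom = a.hom ≫ x' →
      y ≫ c.hom = b.hom ≫ y' → 𝓔.push a.hom δ = 𝓔.pull c.hom δ' → mem x' y' δ'
  /-- contains the split `𝔼`-triangles (in particular the zero one, the empty coproduct) -/
  split : ∀ {A B C : 𝒞} {x : A ⟶ B} {y : B ⟶ C}, 𝓔.IsTriangle x y 0 → mem x y 0
  /-- closed under (binary, hence finite) coproducts -/
  sum : ∀ {A B C A' B' C' : 𝒞} {x : A ⟶ B} {y : B ⟶ C} {x' : A' ⟶ B'} {y' : B' ⟶ C'}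
    {δ : 𝓔.Ext C A} {δ' : 𝓔.Ext C' A'}, mem x y δ → mem x' y' δ' →
    mem (biprod.map x x') (biprod.map y y') (𝓔.sum δ δ')
  /-- closed under base change -/
  base_change : ∀ {A B C B' C' : 𝒞} {x : A ⟶ B} {y : B ⟶ C} {x' : A ⟶ B'} {y' : B' ⟶ C'}
    {δ : 𝓔.Ext C A} (c : C' ⟶ C), mem x y δ →
    𝓔.IsTriangle x' y' (𝓔.pull c δ) → mem x' y' (𝓔.pull c δ)
  /-- closed under cobase change -/
  cobase_change : ∀ {A B C A' B' : 𝒞} {x : A ⟶ B} {y : B ⟶ C} {x' : A' ⟶ B'} {y' : B' ⟶ C}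
    {δ : 𝓔.Ext C A} (a : A ⟶ A'), mem x y δ →
    𝓔.IsTriangle x' y' (𝓔.push a δ) → mem x' y' (𝓔.push a δ)
  /-- saturated -/
  saturated : ∀ {A₁ B₁ A₂ B₂ C M : 𝒞} {x₁ : A₁ ⟶ B₁} {y₁ : B₁ ⟶ C} {δ₁ : 𝓔.Ext C A₁}
    {x₂ : A₂ ⟶ B₂} {y₂ : B₂ ⟶ C} {δ₂ : 𝓔.Ext C A₂}
    {m₁ : A₁ ⟶ M} {e₁ : M ⟶ B₂} {m₂ : A₂ ⟶ M} {e₂ : M ⟶ B₁},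
    𝓔.IsTriangle x₁ y₁ δ₁ → 𝓔.IsTriangle x₂ y₂ δ₂ →
    m₂ ≫ e₁ = x₂ → m₁ ≫ e₂ = x₁ → e₂ ≫ y₁ = e₁ ≫ y₂ →
    𝓔.IsTriangle m₁ e₁ (𝓔.pull y₂ δ₁) → 𝓔.IsTriangle m₂ e₂ (𝓔.pull y₁ δ₂) →
    mem x₂ y₂ δ₂ → mem m₁ e₁ (𝓔.pull y₂ δ₁) → mem x₁ y₁ δ₁

namespace ProperClass

variable {𝒞 : Type u} [Category.{v} 𝒞] [Preadditive 𝒞] [HasZeroObject 𝒞]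
  [HasBinaryBiproducts 𝒞]
  {𝓔 : Extriangulated.{w} 𝒞} (ξ : ProperClass 𝓔)

/-- `P` is `ξ`-projective: `0 ⟶ 𝒞(P, A) ⟶ 𝒞(P, B) ⟶ 𝒞(P, C) ⟶ 0` is exact for every
`𝔼`-triangle `A ⟶ B ⟶ C ⇢` in `ξ`. -/
def IsProjective (P : 𝒞) : Prop :=
  ∀ ⦃A B C : 𝒞⦄ ⦃x : A ⟶ B⦄ ⦃y : B ⟶ C⦄ ⦃δ : 𝓔.Ext C A⦄, ξ.mem x y δ →
    Function.Injective (fun f : P ⟶ A => f ≫ x) ∧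
    Function.Exact (fun f : P ⟶ A => f ≫ x) (fun g : P ⟶ B => g ≫ y) ∧
    Function.Surjective (fun g : P ⟶ B => g ≫ y)

/-- `I` is `ξ`-injective: `0 ⟶ 𝒞(C, I) ⟶ 𝒞(B, I) ⟶ 𝒞(A, I) ⟶ 0` is exact for every
`𝔼`-triangle `A ⟶ B ⟶ C ⇢` in `ξ`. -/
def IsInjective (I : 𝒞) : Prop :=
  ∀ ⦃A B C : 𝒞⦄ ⦃x : A ⟶ B⦄ ⦃y : B ⟶ C⦄ ⦃δ : 𝓔.Ext C A⦄, ξ.mem x y δ →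
    Function.Injective (fun f : C ⟶ I => y ≫ f) ∧
    Function.Exact (fun f : C ⟶ I => y ≫ f) (fun g : B ⟶ I => x ≫ g) ∧
    Function.Surjective (fun g : B ⟶ I => x ≫ g)

/-- `ξ`-pd `A ≤ n`. -/
def ProjDimLE : ℕ → 𝒞 → Prop
  | 0, A => ξ.IsProjective A
  | n + 1, A => ξ.IsProjective A ∨
      ∃ (K P : 𝒞) (f : K ⟶ P) (g : P ⟶ A) (δ : 𝓔.Ext A K),
        ξ.mem f g δ ∧ ξ.IsProjective P ∧ ProjDimLE n K

/-- `ξ`-id `A ≤ n`. -/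
def InjDimLE : ℕ → 𝒞 → Prop
  | 0, A => ξ.IsInjective A
  | n + 1, A => ξ.IsInjective A ∨
      ∃ (I L : 𝒞) (f : A ⟶ I) (g : I ⟶ L) (δ : 𝓔.Ext L A),
        ξ.mem f g δ ∧ ξ.IsInjective I ∧ InjDimLE n L

/-- The `ξ`-projective dimension (`⊤` if it is infinite). -/
noncomputable def projDim (A : 𝒞) : ℕ∞ := ⨅ (n : ℕ) (_ : ξ.ProjDimLE n A), (n : ℕ∞)

/-- The `ξ`-injective dimension (`⊤` if it is infinite). -/
noncomputable def injDim (A : 𝒞) : ℕ∞ := ⨅ (n : ℕ) (_ : ξ.InjDimLE n A), (n : ℕ∞)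

/-- `ξ`-silp `𝒞`, the supremum of the `ξ`-injective dimensions of the `ξ`-projectives. -/
noncomputable def silp : ℕ∞ := ⨆ (P : 𝒞) (_ : ξ.IsProjective P), ξ.injDim P

/-- `ξ`-spli `𝒞`, the supremum of the `ξ`-projective dimensions of the `ξ`-injectives. -/
noncomputable def spli : ℕ∞ := ⨆ (I : 𝒞) (_ : ξ.IsInjective I), ξ.projDim I

end ProperClass

/-! Suppose every `ξ`-projective has `ξ`-injective dimension at most `n`. In a finite projective
resolution of `M`, a kernel deep enough to be projective has injective dimension at most `n`, so it
has no nonsplit extension in `ξ` by an `n`-th syzygy. The resolution therefore splits off at its far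
end until its length is at most `n` (`ProjDimLE.of_isSyzygy`). For `M` injective this gives spli ≤
silp; the dual `InjDimLE.of_isCosyzygy` gives the other inequality. No higher extension groups are
needed. `ExtVanishes.shift` and `ExtVanishes.unshift` replace `Ext¹(ΩX, Y) ≅ Ext²(X, Y) ≅ Ext¹(X,
ΣY)` by moving both variables at once, and only syzygies that already exist occur, so enough
projectives or injectives are not required. -/

namespace PreExtriangulated

variable {𝒞 : Type u} [Category.{v} 𝒞] [Preadditive 𝒞] (𝓔 : PreExtriangulated.{w} 𝒞)

/-! ### Functoriality of extensions. -/

lemma push_zero {C A A' : 𝒞} (a : A ⟶ A') : 𝓔.push a (0 : 𝓔.Ext C A) = 0 :=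
  map_zero ((𝓔.E.obj (op C)).map a).hom

lemma pull_zero {C C' A : 𝒞} (c : C' ⟶ C) : 𝓔.pull c (0 : 𝓔.Ext C A) = 0 :=
  map_zero ((𝓔.E.map c.op).app A).hom

lemma push_id {C A : 𝒞} (δ : 𝓔.Ext C A) : 𝓔.push (𝟙 A) δ = δ := by
  simp [push]

lemma pull_id {C A : 𝒞} (δ : 𝓔.Ext C A) : 𝓔.pull (𝟙 C) δ = δ := by
  simp [pull]

lemma push_comp {C A A' A'' : 𝒞} (a : A ⟶ A') (a' : A' ⟶ A'') (δ : 𝓔.Ext C A) :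
    𝓔.push (a ≫ a') δ = 𝓔.push a' (𝓔.push a δ) := by
  simp [push]

lemma pull_comp {C C' C'' A : 𝒞} (c' : C'' ⟶ C') (c : C' ⟶ C) (δ : 𝓔.Ext C A) :
    𝓔.pull (c' ≫ c) δ = 𝓔.pull c' (𝓔.pull c δ) := by
  simp [pull]

lemma exists_isTriangle {A C : 𝒞} (δ : 𝓔.Ext C A) :
    ∃ (B : 𝒞) (x : A ⟶ B) (y : B ⟶ C), 𝓔.IsTriangle x y δ := by
  obtain ⟨S, hS⟩ := Quotient.exists_rep (𝓔.s δ)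
  exact ⟨S.mid, S.fst, S.snd, hS.symm⟩

end PreExtriangulated

namespace Extriangulated

variable {𝒞 : Type u} [Category.{v} 𝒞] [Preadditive 𝒞] [HasZeroObject 𝒞]
  [HasBinaryBiproducts 𝒞] (𝓔 : Extriangulated.{w} 𝒞)

/-! ### Splitting, lifting and extension for `𝔼`-triangles. -/

section

variable {A B C : 𝒞} {x : A ⟶ B} {y : B ⟶ C} {δ : 𝓔.Ext C A}

/-- (ET3) maps the triangle to a split one, whose extension class is zero. -/
lemma push_fst_eq_zero (h : 𝓔.IsTriangle x y δ) : 𝓔.push x δ = 0 := by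
  obtain ⟨c, -, hc⟩ := 𝓔.et3 h (𝓔.realize_zero B C) x biprod.inl rfl
  rw [hc, 𝓔.pull_zero]

lemma pull_snd_eq_zero (h : 𝓔.IsTriangle x y δ) : 𝓔.pull y δ = 0 := by
  obtain ⟨a, -, ha⟩ := 𝓔.et3_op (𝓔.realize_zero A B) h biprod.snd y rfl
  rw [← ha, 𝓔.push_zero]

lemma eq_zero_of_retraction (h : 𝓔.IsTriangle x y δ) (r : B ⟶ A) (hr : x ≫ r = 𝟙 A) :
    δ = 0 := by
  rw [← 𝓔.push_id δ, ← hr, 𝓔.push_comp, 𝓔.push_fst_eq_zero h, 𝓔.push_zero]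

lemma eq_zero_of_section (h : 𝓔.IsTriangle x y δ) (s : C ⟶ B) (hs : s ≫ y = 𝟙 C) :
    δ = 0 := by
  rw [← 𝓔.pull_id δ, ← hs, 𝓔.pull_comp, 𝓔.pull_snd_eq_zero h, 𝓔.pull_zero]

/-- Realizing `(c, 𝟙)` into the split triangle and projecting to `L` gives the extension. -/
lemma exists_extension_of_push_eq_zero (h : 𝓔.IsTriangle x y δ) {L : 𝒞} (c : A ⟶ L)
    (hc : 𝓔.push c δ = 0) : ∃ g : B ⟶ L, x ≫ g = c := by
  obtain ⟨b, hb, -⟩ := 𝓔.realize h (𝓔.realize_zero L C) c (𝟙 C) (by rw [hc, 𝓔.pull_zero])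
  exact ⟨b ≫ biprod.fst, by simp [reassoc_of% hb]⟩

lemma exists_lift_of_pull_eq_zero (h : 𝓔.IsTriangle x y δ) {K : 𝒞} (c : K ⟶ C)
    (hc : 𝓔.pull c δ = 0) : ∃ g : K ⟶ B, g ≫ y = c := by
  obtain ⟨b, -, hb⟩ := 𝓔.realize (𝓔.realize_zero A K) h (𝟙 A) c (by rw [hc, 𝓔.push_zero])
  exact ⟨biprod.inr ≫ b, by simp [← hb]⟩

lemma exists_retraction (h : 𝓔.IsTriangle x y δ) (hδ : δ = 0) : ∃ r : B ⟶ A, x ≫ r = 𝟙 A :=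
  𝓔.exists_extension_of_push_eq_zero h (𝟙 A) (by rw [hδ, 𝓔.push_zero])

lemma exists_section (h : 𝓔.IsTriangle x y δ) (hδ : δ = 0) : ∃ s : C ⟶ B, s ≫ y = 𝟙 C :=
  𝓔.exists_lift_of_pull_eq_zero h (𝟙 C) (by rw [hδ, 𝓔.pull_zero])

end

end Extriangulated

namespace ProperClass

variable {𝒞 : Type u} [Category.{v} 𝒞] [Preadditive 𝒞] [HasZeroObject 𝒞]
  [HasBinaryBiproducts 𝒞] {𝓔 : Extriangulated.{w} 𝒞} (ξ : ProperClass 𝓔)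

/-! ### Retracts, vanishing of extensions in `ξ`, and dimension shifting. -/

lemma IsProjective.of_retract {P M : 𝒞} (hP : ξ.IsProjective P) (s : M ⟶ P) (g : P ⟶ M)
    (hs : s ≫ g = 𝟙 M) : ξ.IsProjective M := by
  intro A B C x y δ h
  obtain ⟨hinj, hex, hsurj⟩ := hP h
  refine ⟨fun f f' hf => ?_, fun b => ⟨fun hb => ?_, ?_⟩, fun c => ?_⟩
  · have : g ≫ f = g ≫ f' := hinj (by simpa using congrArg (g ≫ ·) hf)
    simpa [reassoc_of% hs] using congrArg (s ≫ ·) this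
  · obtain ⟨a, ha⟩ := (hex (g ≫ b)).1 (by simpa using congrArg (g ≫ ·) hb)
    exact ⟨s ≫ a, by simpa [reassoc_of% hs] using congrArg (s ≫ ·) ha⟩
  · rintro ⟨a, rfl⟩
    simpa [reassoc_of% hs] using congrArg (s ≫ ·) ((hex ((g ≫ a) ≫ x)).2 ⟨g ≫ a, rfl⟩)
  · obtain ⟨b, hb⟩ := hsurj (g ≫ c)
    exact ⟨s ≫ b, by simpa [reassoc_of% hs] using congrArg (s ≫ ·) hb⟩

lemma IsInjective.of_retract {I M : 𝒞} (hI : ξ.IsInjective I) (s : M ⟶ I) (r : I ⟶ M)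
    (hs : s ≫ r = 𝟙 M) : ξ.IsInjective M := by
  intro A B C x y δ h
  obtain ⟨hinj, hex, hsurj⟩ := hI h
  refine ⟨fun f f' hf => ?_, fun b => ⟨fun hb => ?_, ?_⟩, fun c => ?_⟩
  · have : f ≫ s = f' ≫ s := hinj (by simpa using congrArg (· ≫ s) hf)
    simpa [hs] using congrArg (· ≫ r) this
  · obtain ⟨a, ha⟩ := (hex (b ≫ s)).1 (by simpa using congrArg (· ≫ s) hb)
    exact ⟨a ≫ r, by simpa [hs] using congrArg (· ≫ r) ha⟩
  · rintro ⟨a, rfl⟩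
    simpa [hs] using congrArg (· ≫ r) ((hex (y ≫ a ≫ s)).2 ⟨a ≫ s, rfl⟩)
  · obtain ⟨b, hb⟩ := hsurj (c ≫ s)
    exact ⟨b ≫ r, by simpa [hs] using congrArg (· ≫ r) hb⟩

/-- Every `𝔼`-triangle `Y ⟶ B ⟶ X ⇢` in `ξ` splits. -/
def ExtVanishes (X Y : 𝒞) : Prop :=
  ∀ ⦃B : 𝒞⦄ ⦃x : Y ⟶ B⦄ ⦃y : B ⟶ X⦄ ⦃δ : 𝓔.Ext X Y⦄, ξ.mem x y δ → δ = 0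

variable {ξ}

lemma IsInjective.extVanishes {Y : 𝒞} (hY : ξ.IsInjective Y) (X : 𝒞) : ξ.ExtVanishes X Y := by
  intro B x y δ h
  obtain ⟨r, hr⟩ := (hY h).2.2 (𝟙 Y)
  exact 𝓔.eq_zero_of_retraction (ξ.isTriangle h) r hr

lemma IsProjective.extVanishes {X : 𝒞} (hX : ξ.IsProjective X) (Y : 𝒞) :
    ξ.ExtVanishes X Y := by
  intro B x y δ h
  obtain ⟨s, hs⟩ := (hX h).2.2 (𝟙 X)
  exact 𝓔.eq_zero_of_section (ξ.isTriangle h) s hs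

/-- Dimension shifting in both variables at once, towards the syzygy of `X`. -/
lemma ExtVanishes.shift {K P X Y I L : 𝒞} {k : K ⟶ P} {p : P ⟶ X} {θ : 𝓔.Ext X K}
    {i : Y ⟶ I} {l : I ⟶ L} {ε : 𝓔.Ext L Y} (hXL : ξ.ExtVanishes X L) (hθ : ξ.mem k p θ)
    (hP : ξ.IsProjective P) (hε : ξ.mem i l ε) (hI : ξ.IsInjective I) :
    ξ.ExtVanishes K Y := by
  intro B x y δ h
  -- Injectivity of `I` exhibits `δ` as `c^* ε` for some `c : K ⟶ L`.
  obtain ⟨b, hb⟩ := (hI h).2.2 i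
  obtain ⟨c, -, hc⟩ := 𝓔.et3 (ξ.isTriangle h) (ξ.isTriangle hε) (𝟙 Y) b (by simpa using hb)
  rw [𝓔.push_id] at hc
  obtain ⟨_, x', y', ht⟩ := 𝓔.exists_isTriangle (𝓔.push c θ)
  -- `c_* θ` is an extension of `X` by `L` in `ξ`, so it vanishes and `c` extends over `k`.
  -- Projectivity of `P` then factors `c` through `l`, and `l^* ε = 0`.
  obtain ⟨g, hg⟩ := 𝓔.exists_extension_of_push_eq_zero (ξ.isTriangle hθ) c
    (hXL (ξ.cobase_change c hθ ht))
  obtain ⟨h', hh'⟩ := (hP hε).2.2 g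
  replace hh' : h' ≫ l = g := hh'
  rw [hc, ← hg, ← hh', 𝓔.pull_comp, 𝓔.pull_comp, 𝓔.pull_snd_eq_zero (ξ.isTriangle hε),
    𝓔.pull_zero, 𝓔.pull_zero]

/-- Dimension shifting in both variables at once, towards the cosyzygy of `Y`. -/
lemma ExtVanishes.unshift {K P X Y I L : 𝒞} {k : K ⟶ P} {p : P ⟶ X} {θ : 𝓔.Ext X K}
    {i : Y ⟶ I} {l : I ⟶ L} {ε : 𝓔.Ext L Y} (hKY : ξ.ExtVanishes K Y) (hθ : ξ.mem k p θ)
    (hP : ξ.IsProjective P) (hε : ξ.mem i l ε) (hI : ξ.IsInjective I) :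
    ξ.ExtVanishes X L := by
  intro B x y δ h
  -- Projectivity of `P` exhibits `δ` as `c_* θ`; the vanishing of `c^* ε` will make `c` factor
  -- through `k`.
  obtain ⟨b, hb⟩ := (hP h).2.2 p
  obtain ⟨c, -, hc⟩ := 𝓔.et3_op (ξ.isTriangle hθ) (ξ.isTriangle h) b (𝟙 X)
    (by simpa using hb.symm)
  rw [𝓔.pull_id] at hc
  obtain ⟨_, x', y', ht⟩ := 𝓔.exists_isTriangle (𝓔.pull c ε)
  obtain ⟨g, hg⟩ := 𝓔.exists_lift_of_pull_eq_zero (ξ.isTriangle hε) c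
    (hKY (ξ.base_change c hε ht))
  obtain ⟨h', hh'⟩ := (hI hθ).2.2 g
  replace hh' : k ≫ h' = g := hh'
  rw [← hc, ← hg, ← hh', 𝓔.push_comp, 𝓔.push_comp, 𝓔.push_fst_eq_zero (ξ.isTriangle hθ),
    𝓔.push_zero, 𝓔.push_zero]

/-! ### Syzygies, cosyzygies and monotonicity of the bounds. -/

variable (ξ)

/-- `X` is an `n`-th `ξ`-syzygy of some object. -/
def IsSyzygy : ℕ → 𝒞 → Prop
  | 0, _ => True
  | n + 1, X => ∃ (P M : 𝒞) (f : X ⟶ P) (g : P ⟶ M) (δ : 𝓔.Ext M X),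
      ξ.mem f g δ ∧ ξ.IsProjective P ∧ IsSyzygy n M

/-- `Y` is an `n`-th `ξ`-cosyzygy of some object. -/
def IsCosyzygy : ℕ → 𝒞 → Prop
  | 0, _ => True
  | n + 1, Y => ∃ (M I : 𝒞) (f : M ⟶ I) (g : I ⟶ Y) (δ : 𝓔.Ext Y M),
      ξ.mem f g δ ∧ ξ.IsInjective I ∧ IsCosyzygy n M

variable {ξ}

/-- The chain is truncated at the end far from `X`. -/
lemma IsSyzygy.of_succ {n : ℕ} {X : 𝒞} (h : ξ.IsSyzygy (n + 1) X) : ξ.IsSyzygy n X := by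
  induction n generalizing X with
  | zero => trivial
  | succ n ih =>
    obtain ⟨P, M, f, g, δ, hδ, hP, hM⟩ := h
    exact ⟨P, M, f, g, δ, hδ, hP, ih hM⟩

lemma IsSyzygy.of_le {m n : ℕ} (hmn : m ≤ n) {X : 𝒞} (h : ξ.IsSyzygy n X) :
    ξ.IsSyzygy m X := by
  induction n, hmn using Nat.le_induction with
  | base => exact h
  | succ n _ ih => exact ih h.of_succ

lemma IsCosyzygy.of_succ {n : ℕ} {Y : 𝒞} (h : ξ.IsCosyzygy (n + 1) Y) : ξ.IsCosyzygy n Y := by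
  induction n generalizing Y with
  | zero => trivial
  | succ n ih =>
    obtain ⟨M, I, f, g, δ, hδ, hI, hM⟩ := h
    exact ⟨M, I, f, g, δ, hδ, hI, ih hM⟩

lemma IsCosyzygy.of_le {m n : ℕ} (hmn : m ≤ n) {Y : 𝒞} (h : ξ.IsCosyzygy n Y) :
    ξ.IsCosyzygy m Y := by
  induction n, hmn using Nat.le_induction with
  | base => exact h
  | succ n _ ih => exact ih h.of_succ

lemma IsProjective.projDimLE {P : 𝒞} (hP : ξ.IsProjective P) : ∀ n : ℕ, ξ.ProjDimLE n P
  | 0 => hP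
  | _ + 1 => Or.inl hP

lemma IsInjective.injDimLE {I : 𝒞} (hI : ξ.IsInjective I) : ∀ n : ℕ, ξ.InjDimLE n I
  | 0 => hI
  | _ + 1 => Or.inl hI

lemma ProjDimLE.succ {n : ℕ} {A : 𝒞} (h : ξ.ProjDimLE n A) : ξ.ProjDimLE (n + 1) A := by
  induction n generalizing A with
  | zero => exact Or.inl h
  | succ n ih =>
    obtain h | ⟨K, P, f, g, δ, hδ, hP, hK⟩ := h
    · exact Or.inl h
    · exact Or.inr ⟨K, P, f, g, δ, hδ, hP, ih hK⟩

lemma ProjDimLE.mono {m n : ℕ} (hmn : m ≤ n) {A : 𝒞} (h : ξ.ProjDimLE m A) :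
    ξ.ProjDimLE n A := by
  induction n, hmn using Nat.le_induction with
  | base => exact h
  | succ n _ ih => exact ih.succ

lemma InjDimLE.succ {n : ℕ} {A : 𝒞} (h : ξ.InjDimLE n A) : ξ.InjDimLE (n + 1) A := by
  induction n generalizing A with
  | zero => exact Or.inl h
  | succ n ih =>
    obtain h | ⟨I, L, f, g, δ, hδ, hI, hL⟩ := h
    · exact Or.inl h
    · exact Or.inr ⟨I, L, f, g, δ, hδ, hI, ih hL⟩

lemma InjDimLE.mono {m n : ℕ} (hmn : m ≤ n) {A : 𝒞} (h : ξ.InjDimLE m A) :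
    ξ.InjDimLE n A := by
  induction n, hmn using Nat.le_induction with
  | base => exact h
  | succ n _ ih => exact ih.succ

/-! ### Bounding finite dimensions. -/

/-- Each shift trades one cosyzygy of `Y` for one syzygy step of `X`, until the second variable is
injective. -/
lemma InjDimLE.extVanishes {n : ℕ} {X Y : 𝒞} (hY : ξ.InjDimLE n Y) (hX : ξ.IsSyzygy n X) :
    ξ.ExtVanishes X Y := by
  induction n generalizing X Y with
  | zero => exact IsInjective.extVanishes hY X
  | succ n ih =>
    obtain hY | ⟨I, L, i, l, ε, hε, hI, hL⟩ := hY
    · exact hY.extVanishes X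
    · obtain ⟨P, M, k, p, θ, hθ, hP, hM⟩ := hX
      exact (ih hL hM).shift hθ hP hε hI

lemma ProjDimLE.extVanishes {n : ℕ} {X Y : 𝒞} (hX : ξ.ProjDimLE n X)
    (hY : ξ.IsCosyzygy n Y) : ξ.ExtVanishes X Y := by
  induction n generalizing X Y with
  | zero => exact IsProjective.extVanishes hX Y
  | succ n ih =>
    obtain hX | ⟨K, P, k, p, θ, hθ, hP, hK⟩ := hX
    · exact hX.extVanishes Y
    · obtain ⟨M, I, i, l, ε, hε, hI, hM⟩ := hY
      exact (ih hK hM).unshift hθ hP hε hI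

/-- If all `ξ`-projectives have `ξ`-injective dimension at most `n`, then a `k`-th syzygy of
finite `ξ`-projective dimension has `ξ`-projective dimension at most `n - k`. -/
lemma ProjDimLE.of_isSyzygy {n : ℕ} (hn : ∀ P : 𝒞, ξ.IsProjective P → ξ.InjDimLE n P)
    {m k : ℕ} {M : 𝒞} (hM : ξ.ProjDimLE m M) (hk : ξ.IsSyzygy k M) :
    ξ.ProjDimLE (n - k) M := by
  induction m generalizing k M with
  | zero => exact IsProjective.projDimLE hM _
  | succ m ih =>
    obtain hM | ⟨K, P, f, g, δ, hδ, hP, hK⟩ := hM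
    · exact hM.projDimLE _
    -- The resolution shortens while the syzygy depth grows, so the bound depends on `n` and `k` but
    -- not on `m`.
    have hK' := ih (k := k + 1) hK ⟨P, M, f, g, δ, hδ, hP, hk⟩
    obtain hlt | hle := lt_or_ge k n
    · obtain ⟨j, hj⟩ : ∃ j, n - k = j + 1 := ⟨n - k - 1, by omega⟩
      rw [show n - (k + 1) = j by omega] at hK'
      rw [hj]
      exact Or.inr ⟨K, P, f, g, δ, hδ, hP, hK'⟩
    -- Truncated subtraction makes `K` projective. As `M` is an `n`-th syzygy, the triangle splits
    -- and `M` is a retract of `P`.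
    · rw [show n - (k + 1) = 0 by omega] at hK'
      obtain ⟨s, hs⟩ := 𝓔.exists_section (ξ.isTriangle hδ)
        ((hn K hK').extVanishes (hk.of_le hle) hδ)
      exact (hP.of_retract ξ s g hs).projDimLE _

/-- If all `ξ`-injectives have `ξ`-projective dimension at most `n`, then a `k`-th cosyzygy of
finite `ξ`-injective dimension has `ξ`-injective dimension at most `n - k`. -/
lemma InjDimLE.of_isCosyzygy {n : ℕ} (hn : ∀ I : 𝒞, ξ.IsInjective I → ξ.ProjDimLE n I)
    {m k : ℕ} {M : 𝒞} (hM : ξ.InjDimLE m M) (hk : ξ.IsCosyzygy k M) :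
    ξ.InjDimLE (n - k) M := by
  induction m generalizing k M with
  | zero => exact IsInjective.injDimLE hM _
  | succ m ih =>
    obtain hM | ⟨I, L, f, g, δ, hδ, hI, hL⟩ := hM
    · exact hM.injDimLE _
    have hL' := ih (k := k + 1) hL ⟨M, I, f, g, δ, hδ, hI, hk⟩
    obtain hlt | hle := lt_or_ge k n
    · obtain ⟨j, hj⟩ : ∃ j, n - k = j + 1 := ⟨n - k - 1, by omega⟩
      rw [show n - (k + 1) = j by omega] at hL'
      rw [hj]
      exact Or.inr ⟨I, L, f, g, δ, hδ, hI, hL'⟩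
    · rw [show n - (k + 1) = 0 by omega] at hL'
      obtain ⟨r, hr⟩ := 𝓔.exists_retraction (ξ.isTriangle hδ)
        ((hn L hL').extVanishes (hk.of_le hle) hδ)
      exact (hI.of_retract ξ f r hr).injDimLE _

/-! ### From bounds to numerical dimensions. -/

lemma projDim_le_iff {n : ℕ} {A : 𝒞} : ξ.projDim A ≤ n ↔ ξ.ProjDimLE n A := by
  refine ⟨fun h => ?_, fun h => iInf₂_le n h⟩
  -- A strict bound on the infimum yields an actual witness.
  have h' : ξ.projDim A < ((n + 1 : ℕ) : ℕ∞) :=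
    h.trans_lt (by exact_mod_cast Nat.lt_succ_self n)
  simp only [projDim, iInf_lt_iff] at h'
  obtain ⟨m, hm, hmn⟩ := h'
  exact hm.mono (Nat.lt_succ_iff.1 (by exact_mod_cast hmn))

lemma injDim_le_iff {n : ℕ} {A : 𝒞} : ξ.injDim A ≤ n ↔ ξ.InjDimLE n A := by
  refine ⟨fun h => ?_, fun h => iInf₂_le n h⟩
  have h' : ξ.injDim A < ((n + 1 : ℕ) : ℕ∞) :=
    h.trans_lt (by exact_mod_cast Nat.lt_succ_self n)
  simp only [injDim, iInf_lt_iff] at h'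
  obtain ⟨m, hm, hmn⟩ := h'
  exact hm.mono (Nat.lt_succ_iff.1 (by exact_mod_cast hmn))

lemma silp_le_iff {n : ℕ} :
    ξ.silp ≤ n ↔ ∀ P : 𝒞, ξ.IsProjective P → ξ.InjDimLE n P := by
  simp only [silp, iSup_le_iff, injDim_le_iff]

lemma spli_le_iff {n : ℕ} :
    ξ.spli ≤ n ↔ ∀ I : 𝒞, ξ.IsInjective I → ξ.ProjDimLE n I := by
  simp only [spli, iSup_le_iff, projDim_le_iff]

end ProperClass

theorem mainTheorem9 {𝒞 : Type u} [Category.{v} 𝒞] [Preadditive 𝒞]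
    [HasZeroObject 𝒞] [HasBinaryBiproducts 𝒞]
    (𝓔 : Extriangulated.{w} 𝒞) (ξ : ProperClass 𝓔)
    (hsilp : ξ.silp < ⊤) (hspli : ξ.spli < ⊤) :
    ξ.silp = ξ.spli := by
  obtain ⟨n, hn⟩ := ENat.ne_top_iff_exists.1 hsilp.ne
  obtain ⟨m, hm⟩ := ENat.ne_top_iff_exists.1 hspli.ne
  have hn' := ProperClass.silp_le_iff.1 hn.ge
  have hm' := ProperClass.spli_le_iff.1 hm.ge
  apply le_antisymm
  · rw [← hm]
    -- Depth `k = 0` imposes no condition on `P`, and the finite bound `n` improves to `m - 0`.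
    exact ProperClass.silp_le_iff.2 fun P hP =>
      (hn' P hP).of_isCosyzygy (k := 0) hm' trivial
  · rw [← hn]
    exact ProperClass.spli_le_iff.2 fun I hI =>
      (hm' I hI).of_isSyzygy (k := 0) hn' trivial
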